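/- Let $\mathcal G$ be a Grothendieck category (abelian, with a generator, small colimits, and exact filtered colimits). A cotorsion pair in an abelian category is a pair $(\mathcal A,\mathcal B)$ of classes of objects such that $\mathcal A=\{X : \operatorname{Ext}^1(X,B)=0 \text{ for all } B\in\mathcal B\}$ and $\mathcal B=\{Y : \operatorname{Ext}^1(A,Y)=0 \text{ for all } A\in\mathcal A\}$. It is called small if there is a set $I$ of monomorphisms such that (i) $\mathcal B=\{Y : \operatorname{Ext}^1(\operatorname{coker} i,Y)=0 \text{ for all } i\in I\}$, and (ii) every object $X$ for which $\operatorname{Hom}(i,X)$ is surjective for all $i\in I$ belongs to $\mathcal B$. Let $\operatorname{Ch}(\mathcal G)$ be the category of unbounded complexes $X=(X^n,d^n\colon X^n\to X^{n+1})_{n\in\mathbb Z}$ in $\mathcal G$ (equivalently, chain complexes with $X_n=X^{-n}$), and let $\mathcal E$ be the class of exact complexes. For a class $\mathcal P$ of objects of $\mathcal G$, let $\widetilde{\mathcal P}$ be the class of all $X\in\mathcal E$ all of whose cycle objects $\ker d^n$ lie in $\mathcal P$. Let $dg\widetilde{\mathcal A}$ be the class of all complexes $X$ with $X^n\in\mathcal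 A$ for all $n$ such that the total Hom complex $\operatorname{Hom}(X,Y)$ is exact for every $Y\in\widetilde{\mathcal B}$, and let $dg\widetilde{\mathcal B}$ be the class of all complexes $Y$ with $Y^n\in\mathcal B$ for all $n$ such that $\operatorname{Hom}(X,Y)$ is exact for every $X\in\widetilde{\mathcal A}$. Let $(\mathcal A,\mathcal B)$ be a small cotorsion pair in $\mathcal G$ such that $\mathcal A$ contains a generator of $\mathcal G$. Then $(dg\widetilde{\mathcal A},\widetilde{\mathcal B})$ and $(\widetilde{\mathcal A},dg\widetilde{\mathcal B})$ are cotorsion pairs in $\operatorname{Ch}(\mathcal G)$ (the induced cotorsion pairs), and the following are equivalent: 1. The induced cotorsion pairs are compatible, that is, $dg\widetilde{\mathcal A}\cap\mathcal E=\widetilde{\mathcal A}$ and $dg\widetilde{\mathcal B}\cap\mathcal E=\widetilde{\mathcal B}$. 2. $\mathcal A$ is resolving and $\mathcal B$ is coresolving, that is, for every short exact sequence $0\to X'\to X\to X''\to 0$ in $\mathcal G$: if $X,X''\in\mathcal A$ then $X'\in\mathcal A$, and if $X',X\in\mathcal B$ then $X''\in\mathcal B$. 3. $\operatorname{Ext}^n_{\mathcal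 G}(A,B)=0$ for all $n>0$, $A\in\mathcal A$ and $B\in\mathcal B$. 4. $\widetilde{\mathcal A}=dg\widetilde{\mathcal A}\cap\mathcal E$. -/

import Mathlib

open CategoryTheory CategoryTheory.Limits CategoryTheory.Abelian

universe w v u

namespace CotorsionPairs

section AbelianCategory

variable {C : Type u} [Category.{v} C] [Abelian C]

/-- `(A, B)` is a cotorsion pair: `A` is the class of all `X` with `Ext¹(X, Y) = 0` for all `Y` in
`B`, and `B` is the class of all `Y` with `Ext¹(X, Y) = 0` for all `X` in `A`. -/
structure IsCotorsionPair [HasExt.{w} C] (A B : ObjectProperty C) : Prop where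
  left_iff : ∀ X : C, A X ↔ ∀ Y : C, B Y → Subsingleton (Ext.{w} X Y 1)
  right_iff : ∀ Y : C, B Y ↔ ∀ X : C, A X → Subsingleton (Ext.{w} X Y 1)

/-- `(A, B)` is a small cotorsion pair: there is a set of monomorphisms `i s : M s ⟶ N s` whose
cokernels cogenerate the pair (that is, `B` is exactly the class of all `Y` with
`Ext¹(coker (i s), Y) = 0` for all `s`), such that any `X` for which every `M s ⟶ X` extends along
`i s` lies in `B`. -/
structure IsSmallCotorsionPair [HasExt.{w} C] (A B : ObjectProperty C) : Prop where
  isCotorsionPair : IsCotorsionPair.{w} A B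
  exists_generatingMonos : ∃ (ι : Type w) (M N : ι → C) (i : ∀ s, M s ⟶ N s),
    (∀ s, Mono (i s)) ∧
    (∀ Y : C, B Y ↔ ∀ s, Subsingleton (Ext.{w} (cokernel (i s)) Y 1)) ∧
    (∀ X : C, (∀ s (f : M s ⟶ X), ∃ g : N s ⟶ X, i s ≫ g = f) → B X)

/-- `A` contains a generator of the category. -/
def ContainsGenerator (A : ObjectProperty C) : Prop :=
  ∃ G : C, A G ∧ IsSeparator G

/-- `A` is closed under kernels of epimorphisms between its objects. -/
def IsResolving (A : ObjectProperty C) : Prop :=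
  ∀ S : ShortComplex C, S.ShortExact → A S.X₂ → A S.X₃ → A S.X₁

/-- `B` is closed under cokernels of monomorphisms between its objects. -/
def IsCoresolving (B : ObjectProperty C) : Prop :=
  ∀ S : ShortComplex C, S.ShortExact → B S.X₁ → B S.X₂ → B S.X₃

end AbelianCategory

section Complexes

variable {C : Type u} [Category.{v} C] [Abelian C]

variable (C) in
/-- The class of exact unbounded complexes. -/
def exactComplexes : ObjectProperty (CochainComplex C ℤ) :=
  fun X => X.Acyclic

/-- The exact complexes all of whose cycle objects lie in `P`. -/
def tilde (P : ObjectProperty C) : ObjectProperty (CochainComplex C ℤ) :=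
  fun X => X.Acyclic ∧ ∀ n : ℤ, P (X.cycles n)

/-- The complexes `X` with all components in `A` such that the Hom complex `Hom(X, Y)` is exact
for every exact complex `Y` with cycles in `B`. -/
def dgLeft (A B : ObjectProperty C) : ObjectProperty (CochainComplex C ℤ) :=
  fun X => (∀ n : ℤ, A (X.X n)) ∧
    ∀ Y : CochainComplex C ℤ, tilde B Y → (CochainComplex.HomComplex X Y).Acyclic

/-- The complexes `Y` with all components in `B` such that the Hom complex `Hom(X, Y)` is exact
for every exact complex `X` with cycles in `A`. -/
def dgRight (A B : ObjectProperty C) : ObjectProperty (CochainComplex C ℤ) :=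
  fun Y => (∀ n : ℤ, B (Y.X n)) ∧
    ∀ X : CochainComplex C ℤ, tilde A X → (CochainComplex.HomComplex X Y).Acyclic

/-- Compatibility of the two pairs of classes of complexes `(dg A, tilde B)` and
`(tilde A, dg B)`. -/
def InducedCompatible (A B : ObjectProperty C) : Prop :=
  dgLeft A B ⊓ exactComplexes C = tilde A ∧ dgRight A B ⊓ exactComplexes C = tilde B

end Complexes

end CotorsionPairs

/-! The induced pairs are cotorsion pairs because a degreewise split extension of complexes is
classified by a degree-one cocycle of the Hom complex, so acyclic Hom complexes force `Ext¹ = 0`.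
Conversely, disks test the components of a complex, and spheres test its exactness and its cycles.

For the equivalences, let `Y` be in `B` and take the mapping cone of an injective coresolution `Y →
J`. It is exact and lies in `dgRight A B`, and its cycles are the cosyzygies of `Y`. If exact
objects of `dgRight A B` lie in `tilde B`, these cosyzygies are in `B`, and dimension shifting gives
1 → 3 (`exists_cosyzygy`, `subsingleton_ext_of_tilde`). Long exact sequences give 3 → 2. If `B` is
coresolving, the cone lies in `tilde B`; hence `Hom(X, Y)` is acyclic for exact `X` in `dgLeft A B`,
which puts the cycles of `X` in `A` and gives 2 → 4 (`tilde_of_dgLeft_of_acyclic`).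

For 4 → 1, the small object argument embeds an exact `K` in `dgRight A B` into an object of `tilde
B` with cokernel in `dgLeft A B`. The cokernel is exact, hence in `tilde A`, so the embedding splits
and `K` is a retract of an object of `tilde B` (`tilde_of_dgRight_of_acyclic`). -/

namespace CotorsionPairs

/-! ### Vanishing of `Ext¹`, lifting and splitting. -/

section Extensions

variable {C : Type u} [Category.{v} C] [Abelian C]

/-- The short exact sequence embedding an object into an injective object. -/
lemma exists_shortExact_injective [EnoughInjectives C] (Y : C) :
    ∃ (J Z : C) (i : Y ⟶ J) (p : J ⟶ Z) (w : i ≫ p = 0), Injective J ∧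
      (ShortComplex.mk i p w).ShortExact :=
  ⟨_, _, Injective.ι Y, cokernel.π _, cokernel.condition _, inferInstance,
    { exact := ShortComplex.exact_cokernel _ }⟩

variable [HasExt.{w} C]

/-- Morphisms out of the kernel extend when `Ext¹` of the cokernel vanishes. -/
lemma exists_extension_of_ext_one {S : ShortComplex C} (hS : S.ShortExact) {Y : C}
    (h : Subsingleton (Ext.{w} S.X₃ Y 1)) (f : S.X₁ ⟶ Y) : ∃ g : S.X₂ ⟶ Y, S.f ≫ g = f := by
  obtain ⟨x, hx⟩ := Ext.contravariant_sequence_exact₁ hS Y (Ext.mk₀ f) (add_zero 1)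
    (Subsingleton.elim _ _)
  obtain ⟨g, rfl⟩ := (Ext.mk₀_bijective S.X₂ Y).2 x
  rw [Ext.mk₀_comp_mk₀] at hx
  exact ⟨g, (Ext.mk₀_bijective _ _).1 hx⟩

/-- Morphisms into the cokernel lift when `Ext¹` with values in the kernel vanishes. -/
lemma exists_lift_of_ext_one {S : ShortComplex C} (hS : S.ShortExact) {X : C}
    (h : Subsingleton (Ext.{w} X S.X₁ 1)) (f : X ⟶ S.X₃) : ∃ g : X ⟶ S.X₂, g ≫ S.g = f := by
  obtain ⟨x, hx⟩ := Ext.covariant_sequence_exact₃ X hS (Ext.mk₀ f) (zero_add 1)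
    (Subsingleton.elim _ _)
  obtain ⟨g, rfl⟩ := (Ext.mk₀_bijective X S.X₂).2 x
  rw [Ext.mk₀_comp_mk₀] at hx
  exact ⟨g, (Ext.mk₀_bijective _ _).1 hx⟩

lemma subsingleton_ext_one_of_lift {S : ShortComplex C} (hS : S.ShortExact) {X : C}
    (h₂ : Subsingleton (Ext.{w} X S.X₂ 1))
    (h : ∀ f : X ⟶ S.X₃, ∃ g : X ⟶ S.X₂, g ≫ S.g = f) : Subsingleton (Ext.{w} X S.X₁ 1) := by
  refine subsingleton_of_forall_eq 0 fun x => ?_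
  obtain ⟨x₃, rfl⟩ := Ext.covariant_sequence_exact₁ X hS x (Subsingleton.elim _ _) (zero_add 1)
  obtain ⟨f, rfl⟩ := (Ext.mk₀_bijective _ _).2 x₃
  obtain ⟨g, rfl⟩ := h f
  rw [← Ext.mk₀_comp_mk₀, Ext.comp_assoc_of_second_deg_zero, hS.comp_extClass, Ext.comp_zero]

lemma subsingleton_ext_one_of_extension {S : ShortComplex C} (hS : S.ShortExact) {Y : C}
    (h₂ : Subsingleton (Ext.{w} S.X₂ Y 1))
    (h : ∀ f : S.X₁ ⟶ Y, ∃ g : S.X₂ ⟶ Y, S.f ≫ g = f) : Subsingleton (Ext.{w} S.X₃ Y 1) := by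
  refine subsingleton_of_forall_eq 0 fun x => ?_
  obtain ⟨x₃, rfl⟩ := Ext.contravariant_sequence_exact₃ hS Y x (Subsingleton.elim _ _) (add_zero 1)
  obtain ⟨f, rfl⟩ := (Ext.mk₀_bijective _ _).2 x₃
  obtain ⟨g, rfl⟩ := h f
  rw [← Ext.mk₀_comp_mk₀, hS.extClass_comp_assoc]

lemma subsingleton_ext_of_injective (X J : C) [Injective J] (n : ℕ) :
    Subsingleton (Ext.{w} X J (n + 1)) :=
  subsingleton_of_forall_eq 0 fun x => Ext.eq_zero_of_injective x

/-- `Ext¹(X, Y)` vanishes if every extension of `X` by `Y` has a section. -/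
lemma subsingleton_ext_one_of_section [EnoughInjectives C] {X Y : C}
    (h : ∀ (E : C) (i : Y ⟶ E) (p : E ⟶ X) (w : i ≫ p = 0), (ShortComplex.mk i p w).ShortExact →
      ∃ s : X ⟶ E, s ≫ p = 𝟙 X) : Subsingleton (Ext.{w} X Y 1) := by
  -- Pull the injective presentation of `Y` back along `f : X ⟶ Z`: a section of this extension of
  -- `X` by `Y` is a lift of `f` to `J`.
  obtain ⟨J, Z, i, p, w, hJ, hS⟩ := exists_shortExact_injective Y
  refine subsingleton_ext_one_of_lift hS (subsingleton_ext_of_injective _ _ _) fun f => ?_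
  have : Epi p := hS.epi_g
  have : Mono i := hS.mono_f
  have sq := IsPullback.of_hasPullback p f
  let j : Y ⟶ pullback p f := pullback.lift i 0 (by simp [w])
  have hj : j ≫ pullback.fst p f = i := pullback.lift_fst _ _ _
  have wj : j ≫ pullback.snd p f = 0 := pullback.lift_snd _ _ _
  have : Mono j := mono_of_mono_fac hj
  have hex : (ShortComplex.mk j (pullback.snd p f) wj).Exact := by
    refine ShortComplex.exact_of_f_is_kernel _ (KernelFork.IsLimit.ofι _ _
      (fun {W} g hg => hS.exact.lift (g ≫ pullback.fst p f) ?_) ?_ ?_)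
    · dsimp
      rw [Category.assoc, pullback.condition, reassoc_of% hg, zero_comp]
    · intro W g hg
      apply pullback.hom_ext
      · rw [Category.assoc, hj]
        exact hS.exact.lift_f _ _
      · rw [Category.assoc, wj, comp_zero, hg]
    · intro W g hg m hm
      rw [← cancel_mono j, hm]
      apply pullback.hom_ext
      · rw [Category.assoc, hj]
        exact (hS.exact.lift_f _ _).symm
      · rw [Category.assoc, wj, comp_zero, hg]
  obtain ⟨s, hs⟩ := h _ j (pullback.snd p f) wj { exact := hex }
  exact ⟨s ≫ pullback.fst p f, by
    dsimp
    rw [Category.assoc, pullback.condition, reassoc_of% hs]⟩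

/-- `Ext¹(X, Y)` vanishes if every extension of `X` by `Y` has a retraction. -/
lemma subsingleton_ext_one_of_retraction [EnoughInjectives C] {X Y : C}
    (h : ∀ (E : C) (i : Y ⟶ E) (p : E ⟶ X) (w : i ≫ p = 0), (ShortComplex.mk i p w).ShortExact →
      ∃ r : E ⟶ Y, i ≫ r = 𝟙 Y) : Subsingleton (Ext.{w} X Y 1) :=
  subsingleton_ext_one_of_section fun E i p w hS => by
    obtain ⟨r, hr⟩ := h E i p w hS
    let σ := ShortComplex.Splitting.ofExactOfRetraction _ hS.exact r hr hS.epi_g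
    exact ⟨σ.s, σ.s_g⟩

/-- If `S` and `T` are short exact and `Ext¹(S.X₃, T.X₁) = 0`, then `S.f` has the left lifting
property with respect to `T.g`. -/
lemma hasLiftingProperty_of_ext_one {S T : ShortComplex C} (hS : S.ShortExact) (hT : T.ShortExact)
    (h : Subsingleton (Ext.{w} S.X₃ T.X₁ 1)) : HasLiftingProperty S.f T.g where
  sq_hasLift {t b} sq := by
    have : Epi S.g := hS.epi_g
    have : Mono T.f := hT.mono_f
    -- a lift up to a correction factoring through the kernel
    obtain ⟨x, hx⟩ : ∃ x : Ext.{w} S.X₂ T.X₂ 0, x.comp (Ext.mk₀ T.g) (add_zero 0) = Ext.mk₀ b := by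
      apply Ext.covariant_sequence_exact₃ S.X₂ hT (Ext.mk₀ b) (zero_add 1)
      -- The obstruction to lifting `b` dies on `S.X₁`, where `t` is a lift, so it comes from
      -- `Ext¹(S.X₃, T.X₁) = 0`.
      obtain ⟨y, hy⟩ := Ext.contravariant_sequence_exact₂ hS T.X₁
        ((Ext.mk₀ b).comp hT.extClass (zero_add 1)) (by
          rw [Ext.mk₀_comp_mk₀_assoc, ← sq.w, ← Ext.mk₀_comp_mk₀,
            Ext.comp_assoc_of_second_deg_zero, hT.comp_extClass, Ext.comp_zero])
      rw [← hy, Subsingleton.elim y 0, Ext.comp_zero]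
    obtain ⟨l, rfl⟩ := (Ext.mk₀_bijective _ _).2 x
    rw [Ext.mk₀_comp_mk₀] at hx
    replace hx : l ≫ T.g = b := (Ext.mk₀_bijective _ _).1 hx
    have hk : (t - S.f ≫ l) ≫ T.g = 0 := by
      rw [Preadditive.sub_comp, Category.assoc, hx, sq.w, sub_self]
    obtain ⟨e, he⟩ := exists_extension_of_ext_one hS h (hT.exact.lift _ hk)
    refine ⟨⟨⟨l + e ≫ T.f, ?_, ?_⟩⟩⟩
    · rw [Preadditive.comp_add, reassoc_of% he, hT.exact.lift_f]
      abel
    · rw [Preadditive.add_comp, Category.assoc, T.zero, comp_zero, add_zero, hx]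

lemma ext_subsingleton_of_iso {X X' Y Y' : C} (e : X ≅ X') (e' : Y ≅ Y') (n : ℕ)
    (h : Subsingleton (Ext.{w} X Y n)) : Subsingleton (Ext.{w} X' Y' n) := by
  refine subsingleton_of_forall_eq 0 fun x => ?_
  have h₁ := Subsingleton.elim (((Ext.mk₀ e.hom).comp x (zero_add n)).comp (Ext.mk₀ e'.inv)
    (add_zero n)) 0
  have h₂ := congrArg (fun y => ((Ext.mk₀ e.inv).comp y (zero_add n)).comp (Ext.mk₀ e'.hom)
    (add_zero n)) h₁
  simpa using h₂

end Extensions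

/-! ### Closure properties of cotorsion pairs. -/

section CotorsionPair

variable {C : Type u} [Category.{v} C] [Abelian C] [HasExt.{w} C] {A B : ObjectProperty C}

namespace IsCotorsionPair

variable (h : IsCotorsionPair.{w} A B)
include h

lemma ext_one {X Y : C} (hX : A X) (hY : B Y) : Subsingleton (Ext.{w} X Y 1) :=
  (h.left_iff X).1 hX Y hY

lemma left_of_iso {X X' : C} (e : X ≅ X') (hX : A X) : A X' :=
  (h.left_iff _).2 fun _ hY => ext_subsingleton_of_iso e (Iso.refl _) 1 (h.ext_one hX hY)

lemma right_of_iso {Y Y' : C} (e : Y ≅ Y') (hY : B Y) : B Y' :=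
  (h.right_iff _).2 fun _ hX => ext_subsingleton_of_iso (Iso.refl _) e 1 (h.ext_one hX hY)

lemma left_of_shortExact {S : ShortComplex C} (hS : S.ShortExact) (h₁ : A S.X₁) (h₃ : A S.X₃) :
    A S.X₂ :=
  (h.left_iff _).2 fun Y hY => subsingleton_of_forall_eq 0 fun x => by
    have := h.ext_one h₁ hY
    have := h.ext_one h₃ hY
    obtain ⟨y, rfl⟩ := Ext.contravariant_sequence_exact₂ hS Y x (Subsingleton.elim _ _)
    rw [Subsingleton.elim y 0, Ext.comp_zero]

lemma right_of_shortExact {S : ShortComplex C} (hS : S.ShortExact) (h₁ : B S.X₁) (h₃ : B S.X₃) :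
    B S.X₂ :=
  (h.right_iff _).2 fun X hX => subsingleton_of_forall_eq 0 fun x => by
    have := h.ext_one hX h₁
    have := h.ext_one hX h₃
    obtain ⟨y, rfl⟩ := Ext.covariant_sequence_exact₂ X hS x (Subsingleton.elim _ _)
    rw [Subsingleton.elim y 0, Ext.zero_comp]

lemma right_of_injective (J : C) [Injective J] : B J :=
  (h.right_iff _).2 fun X _ => subsingleton_ext_of_injective X J 0

lemma right_of_isZero {J : C} (hJ : IsZero J) : B J :=
  have := hJ.injective
  h.right_of_injective J

lemma left_of_isZero {P : C} (hP : IsZero P) : A P :=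
  (h.left_iff _).2 fun Y _ => subsingleton_of_forall_eq 0 fun x => by
    have : Ext.mk₀ (𝟙 P) = (0 : Ext.{w} P P 0) := by
      rw [hP.eq_of_src (𝟙 P) 0, Ext.mk₀_zero]
    rw [← Ext.mk₀_id_comp x, this, Ext.zero_comp]

lemma right_of_retract {Y Y' : C} (i : Y' ⟶ Y) (r : Y ⟶ Y') (hr : i ≫ r = 𝟙 Y') (hY : B Y) :
    B Y' :=
  (h.right_iff _).2 fun X hX => subsingleton_of_forall_eq 0 fun x => by
    have := h.ext_one hX hY
    have h₁ := Subsingleton.elim (x.comp (Ext.mk₀ i) (add_zero 1)) 0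
    have h₂ := congrArg (fun y => Ext.comp y (Ext.mk₀ r) (add_zero 1)) h₁
    simpa [hr] using h₂

end IsCotorsionPair

end CotorsionPair

/-! ### Special embeddings by the small object argument. -/

section SmallObjectArgument

open MorphismProperty ZeroObject

variable {C : Type u} [Category.{v} C] [Abelian C] [IsGrothendieckAbelian.{w} C]

/-- In a Grothendieck abelian category, a small family of monomorphisms permits the small object
argument. -/
lemma hasSmallObjectArgument_ofHoms {ι : Type w} {M N : ι → C} (i : ∀ s, M s ⟶ N s)
    (hi : ∀ s, Mono (i s)) : HasSmallObjectArgument.{w} (ofHoms i) := by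
  -- With `κ` exceeding the number of subobjects of every `M s`, maps out of `M s` commute with the
  -- transfinite compositions of monomorphisms of length `κ`.
  obtain ⟨κ, hκ', hκ⟩ := HasCardinalLT.exists_regular_cardinal_forall.{w}
    (fun s => Subobject (M s))
  have : Fact κ.IsRegular := ⟨hκ'⟩
  have : Nonempty κ.ord.ToType := by simpa using hκ'.ne_zero
  have := WellFoundedLT.toOrderBot κ.ord.ToType
  have hle : ofHoms i ≤ monomorphisms C := by
    rintro _ _ _ ⟨s⟩
    exact hi s
  exact ⟨κ, inferInstance, inferInstance,
    { preservesColimit {A B X Y} j hj f hf := by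
        let hf' : (monomorphisms C).TransfiniteCompositionOfShape κ.ord.ToType f :=
          { toTransfiniteCompositionOfShape := hf.toTransfiniteCompositionOfShape
            map_mem j hj := by
              have := (hf.attachCells j hj).pushouts_coproducts
              simp only [ofHoms_homFamily] at this
              refine (?_ : _ ≤ monomorphisms C) _ this
              simp only [pushouts_le_iff, coproducts_le_iff]
              exact hle }
        have (j j' : κ.ord.ToType) (φ : j ⟶ j') : Mono (hf'.F.map φ) := hf'.mem_map φ
        apply IsGrothendieckAbelian.preservesColimit_coyoneda_obj_of_mono (Y := hf'.F) (κ := κ)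
        obtain ⟨s⟩ := hj
        exact hκ s }⟩

/-- Given a small family of short exact sequences `S s`, every object embeds into an object to
which all morphisms from `(S s).X₁` extend along `(S s).f`, with a cokernel that is left
`Ext¹`-orthogonal to all objects to which the `(S s).X₃` are. -/
lemma exists_shortExact_of_generating [HasExt.{w} C] {ι : Type w} {S : ι → ShortComplex C}
    (hS : ∀ s, (S s).ShortExact) (X : C) :
    ∃ (Y Z : C) (j : X ⟶ Y) (p : Y ⟶ Z) (w : j ≫ p = 0), (ShortComplex.mk j p w).ShortExact ∧
      (∀ s (f : (S s).X₁ ⟶ Y), ∃ g : (S s).X₂ ⟶ Y, (S s).f ≫ g = f) ∧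
      ∀ K : C, (∀ s, Subsingleton (Ext.{w} (S s).X₃ K 1)) →
        Subsingleton (Ext.{w} Z K 1) := by
  let i (s : ι) := (S s).f
  have hi (s : ι) : Mono (i s) := (hS s).mono_f
  have := hasSmallObjectArgument_ofHoms i hi
  let fac := (functorialFactorizationData (ofHoms i).rlp.llp (ofHoms i).rlp).factorizationData
    (0 : X ⟶ 0)
  let j := fac.i
  have hj : (ofHoms i).rlp.llp j := fac.hi
  have hmono : Mono j := by
    have hJ : (ofHoms i).rlp (0 : Injective.under X ⟶ 0) := by
      rintro _ _ _ ⟨s⟩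
      have := hi s
      exact ⟨fun {f g} sq => ⟨⟨⟨Injective.factorThru f (i s), Injective.comp_factorThru _ _,
        (isZero_zero C).eq_of_tgt _ _⟩⟩⟩⟩
    have := hj _ hJ
    have sq : CommSq (Injective.ι X) j (0 : Injective.under X ⟶ 0) 0 := ⟨by simp⟩
    exact mono_of_mono_fac sq.fac_left
  refine ⟨fac.Z, cokernel j, j, cokernel.π j, cokernel.condition j,
    { exact := ShortComplex.exact_cokernel j }, fun s f => ?_, fun K hK => ?_⟩
  · have := fac.hp _ (MorphismProperty.ofHoms.mk (f := i) s)
    have sq : CommSq f (i s) fac.p 0 := ⟨(isZero_zero C).eq_of_tgt _ _⟩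
    exact ⟨sq.lift, sq.fac_left⟩
  -- Since `j` lifts against `p`, the projection to `cokernel j` lifts to `E` by a map vanishing on
  -- `X`; it descends to a section.
  · refine subsingleton_ext_one_of_section fun E k p w hE => ?_
    have hp : (ofHoms i).rlp p := by
      rintro _ _ _ ⟨s⟩
      exact hasLiftingProperty_of_ext_one (hS s) hE (hK s)
    have := hj _ hp
    have sq : CommSq (0 : X ⟶ E) j p (cokernel.π j) := ⟨by simp⟩
    exact ⟨cokernel.desc j sq.lift sq.fac_left, by
      rw [← cancel_epi (cokernel.π j), cokernel.π_desc_assoc, Category.comp_id]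
      exact sq.fac_right⟩

end SmallObjectArgument

/-! ### Hom complexes, homotopy classes and `Ext¹` of complexes. -/

section HomComplex

open CochainComplex CochainComplex.HomComplex ZeroObject

variable {C : Type u} [Category.{v} C] [Abelian C]

lemma homComplex_acyclic_iff (X Y : CochainComplex C ℤ) :
    (HomComplex X Y).Acyclic ↔ ∀ (n : ℤ) (z : Cocycle X Y n), z ∈ coboundaries X Y n := by
  refine forall_congr' fun n => ?_
  rw [HomologicalComplex.exactAt_iff_isZero_homology, AddCommGrpCat.isZero_iff_subsingleton,
    (homologyAddEquiv X Y n).toEquiv.subsingleton_congr]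
  constructor
  · intro h z
    rw [← CohomologyClass.mk_eq_zero_iff]
    exact Subsingleton.elim _ _
  · intro h
    refine subsingleton_of_forall_eq 0 fun x => ?_
    obtain ⟨z, rfl⟩ := x.mk_surjective
    exact (CohomologyClass.mk_eq_zero_iff z).2 (h z)

lemma forall_mem_coboundaries_iff (X Y : CochainComplex C ℤ) (n : ℤ) :
    (∀ z : Cocycle X Y n, z ∈ coboundaries X Y n) ↔
      ∀ f : X ⟶ Y⟦n⟧, (HomotopyCategory.quotient C _).map f = 0 := by
  constructor
  · intro h f
    have := (CohomologyClass.toHom_mk_eq_zero_iff (Cocycle.equivHomShift f)).2 (h _)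
    rwa [CohomologyClass.toHom_mk, AddEquiv.symm_apply_apply] at this
  · intro h z
    rw [← CohomologyClass.toHom_mk_eq_zero_iff, CohomologyClass.toHom_mk]
    exact h _

lemma homComplex_acyclic_iff_map_eq_zero (X Y : CochainComplex C ℤ) :
    (HomComplex X Y).Acyclic ↔
      ∀ (n : ℤ) (f : X ⟶ Y⟦n⟧), (HomotopyCategory.quotient C _).map f = 0 := by
  simp only [homComplex_acyclic_iff, forall_mem_coboundaries_iff]

lemma quotient_map_shift_eq_zero_iff {X Y : CochainComplex C ℤ} (f : X ⟶ Y) (n : ℤ) :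
    (HomotopyCategory.quotient C _).map (f⟦n⟧') = 0 ↔
      (HomotopyCategory.quotient C _).map f = 0 := by
  let e := (HomotopyCategory.quotient C (ComplexShape.up ℤ)).commShiftIso n
  have h : (HomotopyCategory.quotient C _).map (f⟦n⟧') ≫ e.hom.app Y =
    e.hom.app X ≫ ((HomotopyCategory.quotient C _).map f)⟦n⟧' := e.hom.naturality f
  rw [← Functor.map_eq_zero_iff (CategoryTheory.shiftFunctor (HomotopyCategory C (.up ℤ)) n)
    (f := (HomotopyCategory.quotient C _).map f)]
  constructor
  · intro h'
    rwa [h', zero_comp, eq_comm, Preadditive.IsIso.comp_left_eq_zero] at h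
  · intro h'
    rwa [h', comp_zero, Preadditive.IsIso.comp_right_eq_zero] at h

/-- The cone of the identity, as an extension of `Y⟦1⟧` by `Y`. -/
lemma shortExact_triangleRotateShortComplex (Y : CochainComplex C ℤ) :
    (mappingCone.triangleRotateShortComplex (𝟙 Y)).ShortExact :=
  HomologicalComplex.shortExact_of_degreewise_shortExact _ fun n =>
    (mappingCone.triangleRotateShortComplexSplitting (𝟙 Y) n).shortExact

lemma quotient_map_id_mappingCone_id (Y : CochainComplex C ℤ) :
    𝟙 ((HomotopyCategory.quotient C _).obj (mappingCone (𝟙 Y))) = 0 := by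
  rw [← CategoryTheory.Functor.map_id, HomotopyCategory.quotient_map_eq_zero_iff]
  exact ⟨mappingCone.homotopyToZeroOfId Y⟩

lemma quotient_map_comp_eq_zero {X Y Z : CochainComplex C ℤ} (f : X ⟶ mappingCone (𝟙 Y))
    (g : mappingCone (𝟙 Y) ⟶ Z) : (HomotopyCategory.quotient C _).map (f ≫ g) = 0 := by
  rw [← Category.id_comp g, Functor.map_comp, Functor.map_comp, CategoryTheory.Functor.map_id,
    quotient_map_id_mappingCone_id, zero_comp, comp_zero]

variable [HasExt.{w} (CochainComplex C ℤ)]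

/-- A degree-one cocycle is a map `X ⟶ Y⟦1⟧`. It lifts to the cone of `𝟙 Y`, which is contractible,
so it is null-homotopic. -/
lemma mem_coboundaries_of_ext_one {X Y : CochainComplex C ℤ} (h : Subsingleton (Ext.{w} X Y 1))
    (z : Cocycle X Y 1) : z ∈ coboundaries X Y 1 := by
  refine (forall_mem_coboundaries_iff X Y 1).2 (fun f => ?_) z
  obtain ⟨g, hg⟩ := exists_lift_of_ext_one (shortExact_triangleRotateShortComplex Y) h f
  rw [← hg]
  exact quotient_map_comp_eq_zero _ _

/-- By `h₁` every extension splits degreewise; the failure of the degreewise sections to commute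
with differentials is a cocycle, and a cochain bounding it corrects them. -/
lemma subsingleton_ext_one_of_mem_coboundaries [HasExt.{w} C]
    [EnoughInjectives (CochainComplex C ℤ)] {X Y : CochainComplex C ℤ}
    (h₁ : ∀ n, Subsingleton (Ext.{w} (X.X n) (Y.X n) 1))
    (h₂ : ∀ z : Cocycle X Y 1, z ∈ coboundaries X Y 1) : Subsingleton (Ext.{w} X Y 1) := by
  refine subsingleton_ext_one_of_section fun E i p w hS => ?_
  have sq : CommSq (0 : 0 ⟶ E) (0 : 0 ⟶ X) p (𝟙 X) := ⟨by simp⟩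
  have hsq (n : ℤ) : (sq.map (HomologicalComplex.eval C _ n)).LiftStruct := by
    obtain ⟨g, hg⟩ := Classical.indefiniteDescription _
      (exists_lift_of_ext_one (hS.map_of_exact (HomologicalComplex.eval C _ n)) (h₁ n) (𝟙 _))
    exact ⟨g, ((HomologicalComplex.eval C _ n).map_isZero (isZero_zero _)).eq_of_src _ _,
      hg.trans (CategoryTheory.Functor.map_id (HomologicalComplex.eval C _ n) X).symm⟩
  let hQ : IsColimit (CokernelCofork.ofπ (f := (0 : 0 ⟶ X)) (𝟙 X) (by simp)) :=
    CokernelCofork.IsColimit.ofId _ rfl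
  obtain ⟨α, hα⟩ := (mem_coboundaries_iff _ 0 (by simp)).1
    (h₂ (Lifting.cocycle₁ sq hsq hQ hS.fIsKernel))
  have := Lifting.hasLift sq hsq hQ hS.fIsKernel α hα
  exact ⟨sq.lift, sq.fac_right⟩

end HomComplex

/-! ### Cycles of exact complexes and null-homotopies. -/

section Cycles

variable {C : Type u} [Category.{v} C] [Abelian C]

lemma shortExact_cycles {K : CochainComplex C ℤ} (hK : K.Acyclic) {i j : ℤ} (hij : i + 1 = j) :
    (ShortComplex.mk (K.iCycles i) (K.toCycles i j) (by
      rw [← cancel_mono (K.iCycles j)]; simp)).ShortExact := by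
  have : Epi (K.toCycles i j) := by
    obtain rfl : i = (ComplexShape.up ℤ).prev j := by simp [← hij]
    exact (hK j).epi_toCycles
  refine { exact := ShortComplex.exact_of_f_is_kernel _ ?_ }
  exact KernelFork.IsLimit.ofι _ _
    (fun g hg => K.liftCycles g j (by simp [← hij]) (by
      rw [← K.toCycles_i, reassoc_of% hg, zero_comp]))
    (fun g hg => K.liftCycles_i _ _ _ _)
    (fun g hg m hm => by rw [← cancel_mono (K.iCycles i), hm, K.liftCycles_i])

lemma exists_desc_cycles {K : CochainComplex C ℤ} (hK : K.Acyclic) {i j k : ℤ} (hij : i + 1 = j)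
    (hjk : j + 1 = k) {Z : C} (f : K.X j ⟶ Z) (hf : K.d i j ≫ f = 0) :
    ∃ g : K.cycles k ⟶ Z, K.toCycles j k ≫ g = f := by
  have : Epi (K.toCycles i j) := (shortExact_cycles hK hij).epi_g
  have h := shortExact_cycles hK hjk
  have := h.epi_g
  have hf' : K.iCycles j ≫ f = 0 := by
    rw [← cancel_epi (K.toCycles i j), K.toCycles_i_assoc, hf, comp_zero]
  exact ⟨h.exact.desc f hf', h.exact.g_desc f hf'⟩

lemma exists_lift_cycles (K : CochainComplex C ℤ) {i j : ℤ} (hij : i + 1 = j) {Z : C}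
    (f : Z ⟶ K.X i) (hf : f ≫ K.d i j = 0) : ∃ g : Z ⟶ K.cycles i, g ≫ K.iCycles i = f :=
  ⟨K.liftCycles f j (by simp [← hij]) hf, K.liftCycles_i _ _ _ _⟩

section Homotopy

variable [HasExt.{w} C] {A B : ObjectProperty C} (h : IsCotorsionPair.{w} A B)
include h

/-- Killing cycles, `f` induces maps from the cycles of `X` in degree `j + 1` to those of `Y` in
degree `j`. These extend to the components of `X`, and the extensions form a homotopy with one of
its two terms zero. -/
lemma nonempty_homotopy_zero_of_cycles {X Y : CochainComplex C ℤ} (hX : tilde A X)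
    (hY : tilde B Y) (f : X ⟶ Y) (hf : ∀ n, X.iCycles n ≫ f.f n = 0) :
    Nonempty (Homotopy f 0) := by
  have H (i j : ℤ) (hij : (ComplexShape.up ℤ).Rel j i) :
      ∃ s : X.X i ⟶ Y.X j, X.d j i ≫ s = f.f j ∧ s ≫ Y.d j i = 0 := by
    have hX' := shortExact_cycles hX.1 hij
    have := hX'.epi_g
    obtain ⟨g, hg⟩ : ∃ g : X.cycles i ⟶ Y.X j, X.toCycles j i ≫ g = f.f j :=
      ⟨hX'.exact.desc _ (hf j), hX'.exact.g_desc _ _⟩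
    obtain ⟨g', hg'⟩ := exists_lift_cycles Y hij g (by
      rw [← cancel_epi (X.toCycles j i), reassoc_of% hg, f.comm, ← X.toCycles_i_assoc, hf])

    obtain ⟨s, hs⟩ := exists_extension_of_ext_one (shortExact_cycles hX.1 (i := i) rfl)
      (h.ext_one (hX.2 _) (hY.2 j)) g'
    dsimp at hs
    exact ⟨s ≫ Y.iCycles j, by rw [← X.toCycles_i_assoc, reassoc_of% hs, hg', hg], by simp⟩
  choose s hs₁ hs₂ using H
  have : f = Homotopy.nullHomotopicMap' s := by
    ext n
    rw [Homotopy.nullHomotopicMap'_f (k₂ := n - 1) (k₁ := n) (k₀ := n + 1) (by simp) (by simp),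
      hs₁, hs₂, add_zero]
  rw [this]
  exact ⟨Homotopy.nullHomotopy' s⟩

lemma nonempty_homotopy_zero {X Y : CochainComplex C ℤ} (hX : tilde A X) (hY : tilde B Y)
    (f : X ⟶ Y) : Nonempty (Homotopy f 0) := by
  have hYX (n : ℤ) : B (Y.X n) :=
    h.right_of_shortExact (shortExact_cycles hY.1 rfl) (hY.2 n) (hY.2 (n + 1))
  -- Choose a null-homotopic map agreeing with `f` on cycles: lift the map on cycles to `Y.X j`,
  -- then extend it to `X.X i`. The difference is covered by the previous lemma.
  have H (i j : ℤ) (hij : (ComplexShape.up ℤ).Rel j i) :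
      ∃ s : X.X i ⟶ Y.X j, X.iCycles i ≫ s ≫ Y.d j i = X.iCycles i ≫ f.f i := by
    obtain ⟨g, hg⟩ := exists_lift_of_ext_one (shortExact_cycles hY.1 hij)
      (h.ext_one (hX.2 i) (hY.2 j)) (HomologicalComplex.cyclesMap f i)
    obtain ⟨s, hs⟩ := exists_extension_of_ext_one (shortExact_cycles hX.1 (i := i) rfl)
      (h.ext_one (hX.2 _) (hYX j)) g
    dsimp at hg hs
    exact ⟨s, by rw [reassoc_of% hs, ← Y.toCycles_i, reassoc_of% hg,
      HomologicalComplex.cyclesMap_i]⟩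
  choose s hs using H
  let φ : X ⟶ Y := Homotopy.nullHomotopicMap' s
  obtain ⟨h₀⟩ := nonempty_homotopy_zero_of_cycles h hX hY (f - φ) (fun n => by
    rw [HomologicalComplex.sub_f_apply,
      Homotopy.nullHomotopicMap'_f (k₂ := n - 1) (k₁ := n) (k₀ := n + 1) (by simp) (by simp),
      Preadditive.comp_sub, Preadditive.comp_add, hs, X.iCycles_d_assoc, zero_comp, zero_add,
      sub_self])
  exact ⟨(Homotopy.ofEq (sub_add_cancel f φ).symm).trans
    ((h₀.add (Homotopy.nullHomotopy' s)).trans (Homotopy.ofEq (add_zero _)))⟩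

end Homotopy

end Cycles

/-! ### Shifts, disks and spheres in the classes of complexes. -/

section Complexes

variable {C : Type u} [Category.{v} C] [Abelian C]

section Tilde

lemma tilde_shift {P : ObjectProperty C} (hP : ∀ {X Y : C}, (X ≅ Y) → P X → P Y)
    {K : CochainComplex C ℤ} (hK : tilde P K) (n : ℤ) : tilde P (K⟦n⟧) := by
  let e (i : ℤ) : (K⟦n⟧).sc i ≅ K.sc (n + i) :=
    (CochainComplex.shiftShortComplexFunctorIso C n i (n + i) rfl).app K
  exact ⟨fun i => (ShortComplex.exact_iff_of_iso (e i)).2 (hK.1 (n + i)),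
    fun i => hP (ShortComplex.cyclesMapIso (e i)).symm (hK.2 (n + i))⟩

variable [HasExt.{w} C] {A B : ObjectProperty C} (h : IsCotorsionPair.{w} A B)
include h

lemma left_X_of_tilde {K : CochainComplex C ℤ} (hK : tilde A K) (n : ℤ) : A (K.X n) :=
  h.left_of_shortExact (shortExact_cycles hK.1 rfl) (hK.2 n) (hK.2 (n + 1))

lemma right_X_of_tilde {K : CochainComplex C ℤ} (hK : tilde B K) (n : ℤ) : B (K.X n) :=
  h.right_of_shortExact (shortExact_cycles hK.1 rfl) (hK.2 n) (hK.2 (n + 1))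

lemma homComplex_acyclic_of_tilde {X Y : CochainComplex C ℤ} (hX : tilde A X) (hY : tilde B Y) :
    (CochainComplex.HomComplex X Y).Acyclic := by
  rw [homComplex_acyclic_iff_map_eq_zero]
  intro n f
  rw [HomotopyCategory.quotient_map_eq_zero_iff]
  exact nonempty_homotopy_zero h hX (tilde_shift h.right_of_iso hY n) f

lemma dgLeft_of_tilde {X : CochainComplex C ℤ} (hX : tilde A X) : dgLeft A B X :=
  ⟨left_X_of_tilde h hX, fun _ hY => homComplex_acyclic_of_tilde h hX hY⟩

lemma dgRight_of_tilde {Y : CochainComplex C ℤ} (hY : tilde B Y) : dgRight A B Y :=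
  ⟨right_X_of_tilde h hY, fun _ hX => homComplex_acyclic_of_tilde h hX hY⟩

end Tilde

section Disks

open HomologicalComplex

variable {i j : ℤ} (hij : (ComplexShape.up ℤ).Rel i j)

lemma tilde_double_id {P : ObjectProperty C} (hP : ∀ {X Y : C}, (X ≅ Y) → P X → P Y)
    (h₀ : ∀ Z : C, IsZero Z → P Z) {Z : C} (hZ : P Z) : tilde P (double (𝟙 Z) hij) := by
  have hne : i ≠ j := by
    simp at hij
    lia
  have hd : IsIso ((double (𝟙 Z) hij).d i j) := by
    rw [double_d _ _ hne]
    infer_instance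
  have hex : (double (𝟙 Z) hij).Acyclic := by
    intro k
    by_cases hi : k = i
    · subst hi
      rw [exactAt_iff' _ (k - 1) k j (by simp) (by simpa using hij)]
      exact (ShortComplex.exact_iff_mono _ ((isZero_double_X (𝟙 Z) hij _ (by lia)
        (by simp at hij; lia)).eq_of_src _ _)).2 (inferInstanceAs (Mono ((double (𝟙 Z) hij).d k j)))
    · by_cases hj : k = j
      · subst hj
        rw [exactAt_iff' _ i k (k + 1) (by simp at hij ⊢; lia) (by simp)]
        exact (ShortComplex.exact_iff_epi _ ((isZero_double_X (𝟙 Z) hij _ (by simp at hij; lia)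
          (by lia)).eq_of_tgt _ _)).2 (inferInstanceAs (Epi ((double (𝟙 Z) hij).d i k)))
      · exact ExactAt.of_isZero (isZero_double_X _ _ _ hi hj)
  refine ⟨hex, fun k => ?_⟩
  by_cases hj : k = j
  · subst hj
    have := (double (𝟙 Z) hij).isIso_iCycles k (k + 1) (by simp)
      ((isZero_double_X _ _ _ (by simp at hij; lia) (by lia)).eq_of_tgt _ _)
    exact hP ((asIso ((double (𝟙 Z) hij).iCycles k)) ≪≫ doubleXIso₁ _ hij hne).symm hZ
  · have := (shortExact_cycles hex (i := k - 1) (j := k) (by simp)).epi_g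
    refine h₀ _ ?_
    by_cases hi : k = i
    · exact (isZero_double_X (𝟙 Z) hij (k - 1) (by lia) (by simp at hij; lia)).of_epi
        ((double (𝟙 Z) hij).toCycles (k - 1) k)
    · exact (isZero_double_X (𝟙 Z) hij k hi hj).of_mono ((double (𝟙 Z) hij).iCycles k)

/-- The functoriality of the complex with `X` in two consecutive degrees. -/
noncomputable def doubleIdMap {X Y : C} (f : X ⟶ Y) : double (𝟙 X) hij ⟶ double (𝟙 Y) hij :=
  mkHomFromDouble hij (by simp at hij; lia) (f ≫ (doubleXIso₀ _ hij).inv)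
    (f ≫ (doubleXIso₁ _ hij (by simp at hij; lia)).inv)
    (by rw [double_d _ _ (by simp at hij; lia)]; simp)
    (fun k _ => by rw [double_d_eq_zero₀ _ _ _ _ (by simp at hij; lia), comp_zero])

lemma doubleIdMap_f₀ {X Y : C} (f : X ⟶ Y) : (doubleIdMap hij f).f i =
    (doubleXIso₀ _ hij).hom ≫ f ≫ (doubleXIso₀ _ hij).inv :=
  mkHomFromDouble_f₀ _ _ _ _ _ _

lemma doubleIdMap_f₁ {X Y : C} (f : X ⟶ Y) (h : i ≠ j) : (doubleIdMap hij f).f j =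
    (doubleXIso₁ _ hij h).hom ≫ f ≫ (doubleXIso₁ _ hij h).inv :=
  mkHomFromDouble_f₁ _ _ _ _ _ _

lemma doubleIdMap_comp_eq_zero (S : ShortComplex C) :
    doubleIdMap hij S.f ≫ doubleIdMap hij S.g = 0 := by
  ext
  · simp [doubleIdMap_f₀]
  · simp [doubleIdMap_f₁ _ _ (show i ≠ j by simp at hij; lia)]

lemma shortExact_doubleIdMap {S : ShortComplex C} (hS : S.ShortExact) :
    (ShortComplex.mk _ _ (doubleIdMap_comp_eq_zero hij S)).ShortExact := by
  have hne : i ≠ j := by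
    simp at hij
    lia
  refine shortExact_of_degreewise_shortExact _ fun k => ?_
  by_cases hi : k = i
  · subst hi
    exact ShortComplex.shortExact_of_iso (ShortComplex.isoMk (doubleXIso₀ (𝟙 S.X₁) hij).symm
      (doubleXIso₀ (𝟙 S.X₂) hij).symm (doubleXIso₀ (𝟙 S.X₃) hij).symm
      (by simp [doubleIdMap_f₀]; exact Iso.inv_hom_id_assoc _ _)
      (by simp [doubleIdMap_f₀]; exact Iso.inv_hom_id_assoc _ _)) hS
  · by_cases hj : k = j
    · subst hj
      exact ShortComplex.shortExact_of_iso (ShortComplex.isoMk (doubleXIso₁ (𝟙 S.X₁) hij hne).symm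
        (doubleXIso₁ (𝟙 S.X₂) hij hne).symm (doubleXIso₁ (𝟙 S.X₃) hij hne).symm
        (by simp [doubleIdMap_f₁ _ _ hne]; exact Iso.inv_hom_id_assoc _ _)
        (by simp [doubleIdMap_f₁ _ _ hne]; exact Iso.inv_hom_id_assoc _ _)) hS
    · have hz (Z : C) := isZero_double_X (𝟙 Z) hij k hi hj
      exact { exact := ShortComplex.exact_of_isZero_X₂ _ (hz _)
              mono_f := ⟨fun _ _ _ => (hz _).eq_of_tgt _ _⟩
              epi_g := ⟨fun _ _ _ => (hz _).eq_of_src _ _⟩ }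

/-- The component in degree `i` is forced to be `d` followed by `φ`: disks are right adjoint to
evaluation in the upper degree. -/
lemma exists_hom_to_double_id {K : CochainComplex C ℤ} {Z : C} (φ : K.X j ⟶ Z) (h : i ≠ j) :
    ∃ f : K ⟶ double (𝟙 Z) hij, f.f j = φ ≫ (doubleXIso₁ _ hij h).inv := by
  classical
  let f (k : ℤ) : K.X k ⟶ (double (𝟙 Z) hij).X k :=
    if hi : k = i then eqToHom (by rw [hi]) ≫ K.d i j ≫ φ ≫ (doubleXIso₀ (𝟙 Z) hij).inv ≫
      eqToHom (by rw [hi])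
    else if hj : k = j then eqToHom (by rw [hj]) ≫ φ ≫ (doubleXIso₁ (𝟙 Z) hij h).inv ≫
      eqToHom (by rw [hj])
    else 0
  have h₀ : f i = K.d i j ≫ φ ≫ (doubleXIso₀ (𝟙 Z) hij).inv := by simp [f]
  have h₁ : f j = φ ≫ (doubleXIso₁ (𝟙 Z) hij h).inv := by simp [f, h.symm]
  refine ⟨{ f := f, comm' := fun k l hkl => ?_ }, h₁⟩
  by_cases hl : l = j
  · subst hl
    obtain rfl : k = i := by
      simp at hij hkl
      lia
    rw [h₀, h₁, double_d _ _ h]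
    simp
  · rw [double_d_eq_zero₁ _ _ _ _ hl, comp_zero]
    by_cases hl' : l = i
    · subst hl'
      rw [h₀, K.d_comp_d_assoc, zero_comp]
    · exact (isZero_double_X _ _ _ hl' hl).eq_of_tgt _ _

end Disks

section Spheres

open CochainComplex CochainComplex.HomComplex

variable [HasExt.{w} C] {A B : ObjectProperty C} (h : IsCotorsionPair.{w} A B)
include h

/-- Cocycles out of a sphere are maps into the cycles of `Y`, and coboundaries are those lifting to
the preceding component; the obstruction lies in `Ext¹` from `A` to `B`. -/
lemma dgLeft_single {X : C} (hX : A X) (p : ℤ) :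
    dgLeft A B ((singleFunctor C p).obj X) := by
  refine ⟨fun n => ?_, fun Y hY => (homComplex_acyclic_iff _ _).2 fun n z => ?_⟩
  · by_cases hn : n = p
    · subst hn
      exact h.left_of_iso (HomologicalComplex.singleObjXSelf _ n X).symm hX
    · exact h.left_of_isZero (HomologicalComplex.isZero_single_obj_X _ _ _ _ hn)
  · obtain ⟨f, hf, rfl⟩ := Cocycle.fromSingleMk_surjective z (p + n) rfl _ rfl
    rw [Cocycle.fromSingleMk_mem_coboundaries_iff _ _ _ _ _ (p + n - 1) (by lia)]
    obtain ⟨g, hg⟩ := exists_lift_cycles Y rfl f hf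
    obtain ⟨l, hl⟩ := exists_lift_of_ext_one
      (shortExact_cycles hY.1 (show p + n - 1 + 1 = p + n by lia)) (h.ext_one hX (hY.2 _)) g
    dsimp at hl
    exact ⟨l, by rw [← Y.toCycles_i, reassoc_of% hl, hg]⟩

lemma dgRight_single {Y : C} (hY : B Y) (q : ℤ) :
    dgRight A B ((singleFunctor C q).obj Y) := by
  refine ⟨fun n => ?_, fun X hX => (homComplex_acyclic_iff _ _).2 fun n z => ?_⟩
  · by_cases hn : n = q
    · subst hn
      exact h.right_of_iso (HomologicalComplex.singleObjXSelf _ n Y).symm hY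
    · exact h.right_of_isZero (HomologicalComplex.isZero_single_obj_X _ _ _ _ hn)
  · obtain ⟨f, hf, rfl⟩ := Cocycle.toSingleMk_surjective z (q - n) (by lia) (q - n - 1) (by lia)
    rw [Cocycle.toSingleMk_mem_coboundaries_iff _ _ _ _ _ (q - n + 1) (by lia)]
    obtain ⟨g, hg⟩ := exists_desc_cycles hX.1 (by lia) rfl f hf
    obtain ⟨l, hl⟩ := exists_extension_of_ext_one
      (shortExact_cycles hX.1 (i := q - n + 1) rfl) (h.ext_one (hX.2 _) hY) g
    dsimp at hl
    exact ⟨l, by rw [← X.toCycles_i_assoc, hl, hg]⟩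

end Spheres

end Complexes

/-! ### The induced cotorsion pairs. -/

section InducedPairs

open CochainComplex CochainComplex.HomComplex HomologicalComplex

variable {C : Type u} [Category.{v} C] [Abelian C]

lemma exact_of_forall_lift (S : ShortComplex C) {G : C} (hG : IsSeparator G)
    (h : ∀ f : G ⟶ S.X₂, f ≫ S.g = 0 → ∃ g : G ⟶ S.X₁, g ≫ S.f = f) : S.Exact := by
  rw [ShortComplex.exact_iff_kernel_ι_comp_cokernel_π_zero]
  refine (Preadditive.isSeparator_iff G).1 hG _ fun f => ?_
  obtain ⟨g, hg⟩ := h (f ≫ kernel.ι S.g) (by simp)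
  rw [← Category.assoc, ← hg, Category.assoc, cokernel.condition, comp_zero]

lemma exact_of_forall_extension [EnoughInjectives C] (S : ShortComplex C)
    (h : ∀ (J : C) [Injective J] (f : S.X₂ ⟶ J), S.f ≫ f = 0 → ∃ g : S.X₃ ⟶ J, S.g ≫ g = f) :
    S.Exact := by
  rw [ShortComplex.exact_iff_kernel_ι_comp_cokernel_π_zero]
  obtain ⟨g, hg⟩ := h _ (cokernel.π S.f ≫ Injective.ι _) (by simp)
  rw [← cancel_mono (Injective.ι (cokernel S.f)), Category.assoc, ← hg,
    kernel.condition_assoc, zero_comp, zero_comp]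

lemma acyclic_of_forall_lift {K : CochainComplex C ℤ} {G : C} (hG : IsSeparator G)
    (h : ∀ (i j k : ℤ), i + 1 = j → j + 1 = k → ∀ f : G ⟶ K.X j, f ≫ K.d j k = 0 →
      ∃ g : G ⟶ K.X i, g ≫ K.d i j = f) : K.Acyclic := by
  intro n
  rw [exactAt_iff' _ (n - 1) n (n + 1) (by simp) (by simp)]
  exact exact_of_forall_lift _ hG (h (n - 1) n (n + 1) (by simp) rfl)

lemma acyclic_of_forall_extension [EnoughInjectives C] {K : CochainComplex C ℤ}
    (h : ∀ (i j k : ℤ), i + 1 = j → j + 1 = k → ∀ (J : C) [Injective J] (f : K.X j ⟶ J),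
      K.d i j ≫ f = 0 → ∃ g : K.X k ⟶ J, K.d j k ≫ g = f) : K.Acyclic := by
  intro n
  rw [exactAt_iff' _ (n - 1) n (n + 1) (by simp) (by simp)]
  exact exact_of_forall_extension _ (h (n - 1) n (n + 1) (by simp) rfl)

lemma shortExact_single {S : ShortComplex C} (hS : S.ShortExact) (n : ℤ) :
    (ShortComplex.mk ((single C (.up ℤ) n).map S.f) ((single C (.up ℤ) n).map S.g)
      (by rw [← Functor.map_comp, S.zero, Functor.map_zero])).ShortExact :=
  hS.map_of_exact (single C (.up ℤ) n)

variable [HasExt.{w} C] [HasExt.{w} (CochainComplex C ℤ)] [EnoughInjectives C]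
  [EnoughInjectives (CochainComplex C ℤ)] {A B : ObjectProperty C}
  (h : IsCotorsionPair.{w} A B)

omit [EnoughInjectives C] [EnoughInjectives (CochainComplex C ℤ)] [HasExt.{w} C] in
lemma homComplex_acyclic_of_forall_ext_one {X Y : CochainComplex C ℤ}
    (hXY : ∀ n : ℤ, Subsingleton (Ext.{w} X (Y⟦n⟧) 1)) : (HomComplex X Y).Acyclic := by
  rw [homComplex_acyclic_iff_map_eq_zero]
  intro n f
  let e := (CategoryTheory.shiftFunctorAdd' (CochainComplex C ℤ) (n - 1) 1 n (by simp)).app Y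
  have := (forall_mem_coboundaries_iff X (Y⟦n - 1⟧) 1).1
    (fun z => mem_coboundaries_of_ext_one (hXY (n - 1)) z) (f ≫ e.hom)
  rwa [Functor.map_comp, Preadditive.IsIso.comp_right_eq_zero] at this

omit [EnoughInjectives C] [EnoughInjectives (CochainComplex C ℤ)] [HasExt.{w} C] in
lemma homComplex_acyclic_of_forall_ext_one' {X Y : CochainComplex C ℤ}
    (hXY : ∀ n : ℤ, Subsingleton (Ext.{w} (X⟦n⟧) Y 1)) : (HomComplex X Y).Acyclic := by
  rw [homComplex_acyclic_iff_map_eq_zero]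
  intro n f
  let e := (CategoryTheory.shiftFunctorAdd' (CochainComplex C ℤ) n (1 - n) 1 (by simp)).app Y
  have := (forall_mem_coboundaries_iff (X⟦1 - n⟧) Y 1).1
    (fun z => mem_coboundaries_of_ext_one (hXY (1 - n)) z) (f⟦1 - n⟧' ≫ e.inv)
  rwa [Functor.map_comp, Preadditive.IsIso.comp_right_eq_zero,
    quotient_map_shift_eq_zero_iff] at this

include h

omit [EnoughInjectives C] in
lemma ext_one_of_dgLeft {X Y : CochainComplex C ℤ} (hX : dgLeft A B X) (hY : tilde B Y) :
    Subsingleton (Ext.{w} X Y 1) :=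
  subsingleton_ext_one_of_mem_coboundaries
    (fun n => h.ext_one (hX.1 n) (right_X_of_tilde h hY n))
    ((homComplex_acyclic_iff X Y).1 (hX.2 Y hY) 1)

omit [EnoughInjectives C] in
lemma ext_one_of_dgRight {X Y : CochainComplex C ℤ} (hX : tilde A X) (hY : dgRight A B Y) :
    Subsingleton (Ext.{w} X Y 1) :=
  subsingleton_ext_one_of_mem_coboundaries
    (fun n => h.ext_one (left_X_of_tilde h hX n) (hY.1 n))
    ((homComplex_acyclic_iff X Y).1 (hY.2 X hX) 1)

-- An extension of `X.X n` by `Z` yields an extension of disks. The canonical map from `X` to the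
-- disk on `X.X n` lifts to the disk on `E`, and its component in degree `n` is a section.
omit [EnoughInjectives (CochainComplex C ℤ)] in
lemma dgLeft_of_forall_ext_one {X : CochainComplex C ℤ}
    (hX : ∀ Y, tilde B Y → Subsingleton (Ext.{w} X Y 1)) : dgLeft A B X := by
  refine ⟨fun n => (h.left_iff _).2 fun Z hZ => ?_, fun Y hY =>
    homComplex_acyclic_of_forall_ext_one fun n => hX _ (tilde_shift h.right_of_iso hY n)⟩
  refine subsingleton_ext_one_of_section fun E i p w hS => ?_
  have hn : (ComplexShape.up ℤ).Rel (n - 1) n := by simp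
  have hne : n - 1 ≠ n := by lia
  obtain ⟨f, hf⟩ := exists_hom_to_double_id hn (𝟙 (X.X n)) hne
  obtain ⟨g, hg⟩ := exists_lift_of_ext_one (shortExact_doubleIdMap hn hS)
    (hX _ (tilde_double_id hn h.right_of_iso (fun _ => h.right_of_isZero) hZ)) f
  refine ⟨g.f n ≫ (doubleXIso₁ _ hn hne).hom, ?_⟩
  have := congrArg (fun φ => Hom.f φ n ≫ (doubleXIso₁ _ hn hne).hom) hg
  simpa [hf, doubleIdMap_f₁ _ _ hne] using this

omit [EnoughInjectives (CochainComplex C ℤ)] in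
lemma dgRight_of_forall_ext_one {Y : CochainComplex C ℤ}
    (hY : ∀ X, tilde A X → Subsingleton (Ext.{w} X Y 1)) : dgRight A B Y := by
  refine ⟨fun n => (h.right_iff _).2 fun Z hZ => ?_, fun X hX =>
    homComplex_acyclic_of_forall_ext_one' fun n => hY _ (tilde_shift h.left_of_iso hX n)⟩
  refine subsingleton_ext_one_of_retraction fun E i p w hS => ?_
  have hn : (ComplexShape.up ℤ).Rel n (n + 1) := by simp
  have hne : n ≠ n + 1 := by lia
  let f : double (𝟙 (Y.X n)) hn ⟶ Y := mkHomFromDouble hn hne (𝟙 _) (Y.d n (n + 1)) (by simp)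
    (by simp)
  obtain ⟨g, hg⟩ := exists_extension_of_ext_one (shortExact_doubleIdMap hn hS)
    (hY _ (tilde_double_id hn h.left_of_iso (fun _ => h.left_of_isZero) hZ)) f
  refine ⟨(doubleXIso₀ _ hn).inv ≫ g.f n, ?_⟩
  have := congrArg (fun φ => (doubleXIso₀ _ hn).inv ≫ Hom.f φ n) hg
  simpa [f, doubleIdMap_f₀] using this

-- Spheres on the generator detect exactness. For the cycles, the inclusion of the sphere on
-- `Y.cycles n` extends to the sphere on `E`, and the extension lands in the cycles, giving a
-- retraction.
omit [EnoughInjectives (CochainComplex C ℤ)] in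
lemma tilde_of_forall_ext_one_dgLeft (hgen : ContainsGenerator A) {Y : CochainComplex C ℤ}
    (hY : ∀ X, dgLeft A B X → Subsingleton (Ext.{w} X Y 1)) : tilde B Y := by
  refine ⟨?_, fun n => (h.right_iff _).2 fun Z hZ => ?_⟩
  · obtain ⟨G, hG, hsep⟩ := hgen
    refine acyclic_of_forall_lift hsep fun i j k hij hjk f hf => ?_
    have := mem_coboundaries_of_ext_one (X := (singleFunctor C i).obj G) (hY _ (dgLeft_single h hG i))
      (Cocycle.fromSingleMk f hij k hjk hf)
    rwa [Cocycle.fromSingleMk_mem_coboundaries_iff _ _ _ _ _ i hij] at this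
  · refine subsingleton_ext_one_of_retraction fun E i p w hS => ?_
    let f : (single C (.up ℤ) n).obj (Y.cycles n) ⟶ Y := mkHomFromSingle (Y.iCycles n) (by simp)
    obtain ⟨g, hg⟩ := exists_extension_of_ext_one (shortExact_single hS n)
      (hY _ (dgLeft_single h hZ n)) f
    obtain ⟨r, hr⟩ := exists_lift_cycles Y (i := n) rfl ((singleObjXSelf (.up ℤ) n E).inv ≫ g.f n)
      (by rw [Category.assoc, g.comm]; simp)
    refine ⟨r, ?_⟩
    have := congrArg (fun φ => (singleObjXSelf (.up ℤ) n _).inv ≫ Hom.f φ n) hg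
    rw [← cancel_mono (Y.iCycles n), Category.assoc, hr, Category.id_comp]
    simpa [f, single_map_f_self] using this

-- Dual argument: exactness is detected by spheres on injectives, which always lie in `B`, so no
-- generator is required.
omit [EnoughInjectives (CochainComplex C ℤ)] in
lemma tilde_of_forall_ext_one_dgRight {X : CochainComplex C ℤ}
    (hX : ∀ Y, dgRight A B Y → Subsingleton (Ext.{w} X Y 1)) : tilde A X := by
  have hex : X.Acyclic := by
    refine acyclic_of_forall_extension fun i j k hij hjk J hJ f hf => ?_
    have := mem_coboundaries_of_ext_one (Y := (singleFunctor C k).obj J) (hX _ (dgRight_single h (h.right_of_injective J) k))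
      (Cocycle.toSingleMk f hjk i hij hf)
    rwa [Cocycle.toSingleMk_mem_coboundaries_iff _ _ _ _ _ k hjk] at this
  refine ⟨hex, fun k => (h.left_iff _).2 fun Z hZ => ?_⟩
  refine subsingleton_ext_one_of_section fun E i p w hS => ?_
  let f : X ⟶ (single C (.up ℤ) (k - 1)).obj (X.cycles k) :=
    mkHomToSingle (X.toCycles (k - 1) k) (by simp)
  obtain ⟨g, hg⟩ := exists_lift_of_ext_one (shortExact_single hS (k - 1))
    (hX _ (dgRight_single h hZ (k - 1))) f
  obtain ⟨s, hs⟩ := exists_desc_cycles hex (i := k - 1 - 1) (j := k - 1) (k := k) (by simp)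
    (by simp) (g.f (k - 1) ≫ (singleObjXSelf (.up ℤ) (k - 1) E).hom)
    (by rw [← Category.assoc, ← g.comm]; simp)
  have := (shortExact_cycles hex (i := k - 1) (j := k) (by simp)).epi_g
  refine ⟨s, ?_⟩
  have := congrArg (fun φ => Hom.f φ (k - 1) ≫ (singleObjXSelf (.up ℤ) (k - 1) _).hom) hg
  rw [← cancel_epi (X.toCycles (k - 1) k), reassoc_of% hs, Category.comp_id]
  simpa [f, single_map_f_self] using this

theorem isCotorsionPair_dgLeft_tilde (hgen : ContainsGenerator A) :
    IsCotorsionPair.{w} (dgLeft A B) (tilde B) where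
  left_iff _ := ⟨fun hX _ hY => ext_one_of_dgLeft h hX hY, dgLeft_of_forall_ext_one h⟩
  right_iff _ := ⟨fun hY _ hX => ext_one_of_dgLeft h hX hY,
    tilde_of_forall_ext_one_dgLeft h hgen⟩

theorem isCotorsionPair_tilde_dgRight : IsCotorsionPair.{w} (tilde A) (dgRight A B) where
  left_iff _ := ⟨fun hX _ hY => ext_one_of_dgRight h hX hY, tilde_of_forall_ext_one_dgRight h⟩
  right_iff _ := ⟨fun hY _ hX => ext_one_of_dgRight h hX hY, dgRight_of_forall_ext_one h⟩

end InducedPairs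

/-! ### Mapping cones and acyclicity of Hom complexes. -/

section MappingCone

open CochainComplex CochainComplex.HomComplex HomologicalComplex

variable {C : Type u} [Category.{v} C] [Abelian C]

lemma homComplex_acyclic_iff_shift (X Y : CochainComplex C ℤ) :
    (HomComplex X Y).Acyclic ↔
      ∀ (n : ℤ) (f : (HomotopyCategory.quotient C _).obj X ⟶
        ((HomotopyCategory.quotient C _).obj Y)⟦n⟧), f = 0 := by
  rw [homComplex_acyclic_iff_map_eq_zero]
  refine forall_congr' fun n => ?_
  let e := ((HomotopyCategory.quotient C (.up ℤ)).commShiftIso n).app Y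
  constructor
  · intro h f
    obtain ⟨g, hg⟩ := (HomotopyCategory.quotient C (.up ℤ)).map_surjective (f ≫ e.inv)
    rw [← Preadditive.IsIso.comp_right_eq_zero f e.inv, ← hg]
    exact h g
  · intro h f
    exact (Preadditive.IsIso.comp_right_eq_zero _ e.hom).1 (h _)

lemma eq_zero_of_homComplex_acyclic {X Y : CochainComplex C ℤ} (h : (HomComplex X Y).Acyclic)
    {n m : ℤ} (f : (HomotopyCategory.quotient C _).obj X ⟶
        ((HomotopyCategory.quotient C _).obj Y)⟦n⟧⟦m⟧) : f = 0 :=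
  (Preadditive.IsIso.comp_right_eq_zero f
    ((CategoryTheory.shiftFunctorAdd' (HomotopyCategory C (.up ℤ)) n m _ rfl).inv.app _)).1
    ((homComplex_acyclic_iff_shift X Y).1 h _ _)

variable {X K L : CochainComplex C ℤ} (φ : K ⟶ L)

lemma homComplex_mappingCone_acyclic (hK : (HomComplex X K).Acyclic)
    (hL : (HomComplex X L).Acyclic) : (HomComplex X (mappingCone φ)).Acyclic := by
  rw [homComplex_acyclic_iff_shift]
  intro n f
  obtain ⟨g, hg⟩ := Pretriangulated.Triangle.coyoneda_exact₃ _
    (Pretriangulated.Triangle.shift_distinguished _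
      (HomotopyCategory.mappingCone_triangleh_distinguished φ) n) f
    (eq_zero_of_homComplex_acyclic hK _)
  rw [hg, (homComplex_acyclic_iff_shift X L).1 hL n g]
  exact zero_comp

lemma homComplex_acyclic_of_mappingCone (hL : (HomComplex X L).Acyclic)
    (hM : (HomComplex X (mappingCone φ)).Acyclic) : (HomComplex X K).Acyclic := by
  rw [homComplex_acyclic_iff_shift]
  intro n f
  let e := (CategoryTheory.shiftFunctorAdd' (HomotopyCategory C (.up ℤ)) (n - 1) 1 n
    (by simp)).app ((HomotopyCategory.quotient C _).obj K)
  rw [← Preadditive.IsIso.comp_right_eq_zero f e.hom]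
  obtain ⟨g, hg⟩ := Pretriangulated.Triangle.coyoneda_exact₁ _
    (Pretriangulated.Triangle.shift_distinguished _
      (HomotopyCategory.mappingCone_triangleh_distinguished φ) (n - 1)) (f ≫ e.hom)
    (eq_zero_of_homComplex_acyclic hL _)
  refine hg.trans ?_
  rw [(homComplex_acyclic_iff_shift X _).1 hM (n - 1) g]
  exact zero_comp

lemma mappingCone_acyclic [QuasiIso φ] : (mappingCone φ).Acyclic := by
  rw [← HomotopyCategory.quotient_obj_mem_subcategoryAcyclic_iff_acyclic]
  refine ((HomotopyCategory.subcategoryAcyclic C).trW_iff_of_distinguished _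
    (HomotopyCategory.mappingCone_triangleh_distinguished φ)).1 ?_
  rw [← HomotopyCategory.quasiIso_eq_trW_subcategoryAcyclic]
  exact (HomotopyCategory.quotient_map_mem_quasiIso_iff φ).2 ((HomologicalComplex.mem_quasiIso_iff _).2 ‹_›)

/-- The components of the mapping cone of `φ : K ⟶ L` are extensions of those of `K` by those of
`L`. -/
lemma exists_shortExact_mappingCone_X (n : ℤ) :
    ∃ (i : L.X n ⟶ (mappingCone φ).X n) (p : (mappingCone φ).X n ⟶ K.X (n + 1)) (w : i ≫ p = 0),
      (ShortComplex.mk i p w).ShortExact :=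
  ⟨_, _, _, (mappingCone.triangleRotateShortComplexSplitting φ n).shortExact⟩

lemma homComplex_acyclic_of_isKInjective [L.IsKInjective] (hX : X.Acyclic) :
    (HomComplex X L).Acyclic := by
  rw [homComplex_acyclic_iff_map_eq_zero]
  intro n f
  rw [HomotopyCategory.quotient_map_eq_zero_iff]
  exact IsKInjective.nonempty_homotopy_zero f hX

end MappingCone

/-! ### Cones of injective coresolutions. -/

section Coresolution

open CochainComplex CochainComplex.HomComplex HomologicalComplex

variable {C : Type u} [Category.{v} C] [Abelian C] [EnoughInjectives C]

/-- An object `Y` is quasi-isomorphic to a K-injective complex of injective objects in nonnegative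
degrees. -/
lemma exists_injective_coresolution (Y : C) :
    ∃ (J : CochainComplex C ℤ) (φ : (single C (.up ℤ) 0).obj Y ⟶ J), QuasiIso φ ∧
      J.IsKInjective ∧ (∀ n, Injective (J.X n)) ∧ ∀ n < 0, IsZero (J.X n) := by
  let R := injectiveResolution Y
  exact ⟨R.cochainComplex, R.ι', inferInstanceAs (QuasiIso R.ι'), inferInstance, inferInstance,
    fun n hn => isZero_of_isStrictlyGE _ 0 n hn⟩

variable [HasExt.{w} C] {A B : ObjectProperty C} (h : IsCotorsionPair.{w} A B)
include h

omit [EnoughInjectives C] in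
lemma right_mappingCone_X {Y : C} (hY : B Y) {J : CochainComplex C ℤ}
    (φ : (single C (.up ℤ) 0).obj Y ⟶ J) (hJ : ∀ n, Injective (J.X n)) (n : ℤ) :
    B ((mappingCone φ).X n) := by
  obtain ⟨i, p, w, hS⟩ := exists_shortExact_mappingCone_X φ n
  have := hJ n
  exact h.right_of_shortExact hS (h.right_of_injective _) ((dgRight_single h hY 0).1 _)

/-- If `tilde B` contains the exact complexes in `dgRight A B`, then cosyzygies of objects in `B`
lie in `B`. -/
lemma exists_cosyzygy (hB : ∀ K, dgRight A B K → K.Acyclic → tilde B K) {Y : C} (hY : B Y) :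
    ∃ (S : ShortComplex C) (_ : S.ShortExact), Nonempty (S.X₁ ≅ Y) ∧ Injective S.X₂ ∧ B S.X₃ := by
  obtain ⟨J, φ, _, hJ, hinj, hneg⟩ := exists_injective_coresolution Y
  have hM : (mappingCone φ).Acyclic := mappingCone_acyclic φ
  have hMB := hB _ ⟨right_mappingCone_X h hY φ hinj, fun X hX => homComplex_mappingCone_acyclic φ
    ((dgRight_single h hY 0).2 X hX) (homComplex_acyclic_of_isKInjective hX.1)⟩ hM
  -- The cone is zero below degree `-1`, is `Y` in degree `-1` and `J.X 0` in degree `0`; its cycles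
  -- in degree `0` are therefore `Y`.
  refine ⟨_, shortExact_cycles hM (i := 0) rfl, ?_, ?_, hMB.2 _⟩
  · have hS := shortExact_cycles hM (show -1 + 1 = (0 : ℤ) by simp)
    have hS' := shortExact_cycles hM (show -2 + 1 = (-1 : ℤ) by simp)
    have hz : IsZero ((mappingCone φ).X (-2)) := by
      obtain ⟨i, p, w, hT⟩ := exists_shortExact_mappingCone_X φ (-2)
      exact hT.exact.isZero_of_both_zeros ((hneg _ (by simp)).eq_of_src _ _)
        ((isZero_single_obj_X (.up ℤ) 0 Y (0 + 1) (by simp)).eq_of_tgt _ _)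
    have := hS'.epi_g
    have hz' : IsZero ((mappingCone φ).cycles (-1)) :=
      hz.of_epi ((mappingCone φ).toCycles (-2) (-1))
    have := (hS.isIso_g_iff).2 hz'
    obtain ⟨i, p, w, hT⟩ := exists_shortExact_mappingCone_X φ (-1)
    have := (hT.isIso_g_iff).2 (hneg _ (by simp))
    exact ⟨(asIso ((mappingCone φ).toCycles (-1) 0)).symm ≪≫ asIso p ≪≫ singleObjXSelf _ 0 Y⟩
  · obtain ⟨i, p, w, hT⟩ := exists_shortExact_mappingCone_X φ 0
    have := (hT.isIso_f_iff).2 (isZero_single_obj_X (.up ℤ) 0 Y (0 + 1) (by simp))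
    exact Injective.of_iso (asIso i) (hinj 0)

lemma subsingleton_ext_of_tilde (hB : ∀ K, dgRight A B K → K.Acyclic → tilde B K) (n : ℕ) :
    ∀ X Y : C, A X → B Y → Subsingleton (Ext.{w} X Y (n + 1)) := by
  induction n with
  | zero => exact fun X Y hX hY => h.ext_one hX hY
  | succ n ih =>
    intro X Y hX hY
    obtain ⟨S, hS, ⟨e⟩, _, hS₃⟩ := exists_cosyzygy h hB hY
    have := ih X _ hX hS₃
    refine ext_subsingleton_of_iso (Iso.refl X) e _ (subsingleton_of_forall_eq 0 fun x => ?_)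
    have := subsingleton_ext_of_injective X S.X₂ (n + 1)
    obtain ⟨y, rfl⟩ := Ext.covariant_sequence_exact₁ X hS x (Subsingleton.elim _ _) rfl
    rw [Subsingleton.elim y 0, Ext.zero_comp]

omit [EnoughInjectives C] in
lemma isResolving_of_ext_two (h₂ : ∀ X Y : C, A X → B Y → Subsingleton (Ext.{w} X Y 2)) :
    IsResolving A := fun S hS hX₂ hX₃ =>
  (h.left_iff _).2 fun Y hY => subsingleton_of_forall_eq 0 fun x => by
    have := h₂ _ Y hX₃ hY
    have := h.ext_one hX₂ hY
    obtain ⟨y, rfl⟩ := Ext.contravariant_sequence_exact₁ hS Y x rfl (Subsingleton.elim _ _)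
    rw [Subsingleton.elim y 0, Ext.comp_zero]

omit [EnoughInjectives C] in
lemma isCoresolving_of_ext_two (h₂ : ∀ X Y : C, A X → B Y → Subsingleton (Ext.{w} X Y 2)) :
    IsCoresolving B := fun S hS hX₁ hX₂ =>
  (h.right_iff _).2 fun X hX => subsingleton_of_forall_eq 0 fun x => by
    have := h₂ X _ hX hX₁
    have := h.ext_one hX hX₂
    obtain ⟨y, rfl⟩ := Ext.covariant_sequence_exact₃ X hS x rfl (Subsingleton.elim _ _)
    rw [Subsingleton.elim y 0, Ext.zero_comp]

-- The cycles vanish below degree `-1`; from there coresolvingness propagates membership in `B`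
-- upwards, one short exact sequence of cycles at a time.
omit [EnoughInjectives C] in
lemma tilde_mappingCone (hB : IsCoresolving B) {Y : C} (hY : B Y) {J : CochainComplex C ℤ}
    (φ : (single C (.up ℤ) 0).obj Y ⟶ J) [QuasiIso φ] (hinj : ∀ n, Injective (J.X n))
    (hneg : ∀ n < 0, IsZero (J.X n)) : tilde B (mappingCone φ) := by
  have hM : (mappingCone φ).Acyclic := mappingCone_acyclic φ
  have hcyc (n : ℤ) (hn : n < -1) : B ((mappingCone φ).cycles n) := by
    obtain ⟨i, p, w, hT⟩ := exists_shortExact_mappingCone_X φ n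
    have hz : IsZero ((mappingCone φ).X n) :=
      hT.exact.isZero_of_both_zeros ((hneg _ (by lia)).eq_of_src _ _)
        ((isZero_single_obj_X (.up ℤ) 0 Y _ (by lia)).eq_of_tgt _ _)
    exact h.right_of_isZero (hz.of_mono ((mappingCone φ).iCycles n))
  refine ⟨hM, fun n => ?_⟩
  rcases lt_or_ge n (-2) with hn | hn
  · exact hcyc n (by lia)
  · induction n, hn using Int.leInduction with
    | base => exact hcyc _ (by simp)
    | succ n _ ih =>
      exact hB _ (shortExact_cycles hM (i := n) rfl) ih (right_mappingCone_X h hY φ hinj n)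

lemma tilde_of_dgLeft_of_acyclic (hB : IsCoresolving B) {X : CochainComplex C ℤ}
    (hX : dgLeft A B X) (hex : X.Acyclic) : tilde A X := by
  refine ⟨hex, fun k => (h.left_iff _).2 fun Y hY => ?_⟩
  obtain ⟨J, φ, _, hJ, hinj, hneg⟩ := exists_injective_coresolution Y
  -- Two of the three Hom complexes of the triangle on `Y`, `J` and the cone are acyclic: exactness
  -- of `X` handles `J`, and `tilde B` handles the cone.
  have hY' := homComplex_acyclic_of_mappingCone φ (homComplex_acyclic_of_isKInjective hex)
    (hX.2 _ (tilde_mappingCone h hB hY φ hinj hneg))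
  have hS := shortExact_cycles hex (show k - 1 + 1 = k by simp)
  refine subsingleton_ext_one_of_extension hS (h.ext_one (hX.1 _) hY) fun f => ?_
  have hk : k - 2 + 1 = k - 1 := by lia
  -- Precomposed with `X.toCycles`, `f` becomes a cocycle on `X.X (k - 2)`; bounding it means
  -- extending `f` to `X.X (k - 1)`.
  have := (homComplex_acyclic_iff X ((singleFunctor C 0).obj Y)).1 hY' (2 - k)
    (Cocycle.toSingleMk (p := k - 2) (X.toCycles (k - 2) (k - 1) ≫ f) (by lia) (k - 2 - 1)
      (by lia) (by simp))
  rw [Cocycle.toSingleMk_mem_coboundaries_iff _ _ _ _ _ (k - 1) hk] at this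
  obtain ⟨g, hg⟩ := this
  have := (shortExact_cycles hex hk).epi_g
  exact ⟨g, by
    rw [← cancel_epi (X.toCycles (k - 2) (k - 1)), ← hg, X.toCycles_i_assoc]⟩

end Coresolution

/-! ### Approximation of complexes, and the passage from condition 4 to condition 1. -/

section Completeness

open CochainComplex CochainComplex.HomComplex HomologicalComplex

variable {C : Type u} [Category.{v} C] [Abelian C]

/-- By `h₂` maps from spheres on `G` extend to a contractible cone, so they are null-homotopic and
`K` is exact. By `h₁` the cycles satisfy the extension condition in `hB`. -/
lemma tilde_of_forall_extension_single {B : ObjectProperty C} {ι : Type*} {S : ι → ShortComplex C}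
    (hB : ∀ Y : C, (∀ s (f : (S s).X₁ ⟶ Y), ∃ g : (S s).X₂ ⟶ Y, (S s).f ≫ g = f) → B Y) {G : C}
    (hG : IsSeparator G) {K : CochainComplex C ℤ}
    (h₁ : ∀ s (n : ℤ) (f : (single C (.up ℤ) n).obj (S s).X₁ ⟶ K),
      ∃ g : (single C (.up ℤ) n).obj (S s).X₂ ⟶ K, (single C (.up ℤ) n).map (S s).f ≫ g = f)
    (h₂ : ∀ (n : ℤ) (f : (single C (.up ℤ) n).obj G ⟶ K),
      ∃ g : mappingCone (𝟙 ((single C (.up ℤ) n).obj G)) ⟶ K, mappingCone.inr _ ≫ g = f) :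
    tilde B K := by
  refine ⟨acyclic_of_forall_lift hG fun i j k hij hjk f hf => ?_, fun n => hB _ fun s f => ?_⟩
  · obtain ⟨g, hg⟩ := h₂ j (mkHomFromSingle f (by rintro l rfl; obtain rfl := hjk; exact hf))
    obtain ⟨e⟩ := (HomotopyCategory.quotient_map_eq_zero_iff _).1
      (quotient_map_comp_eq_zero (mappingCone.inr _) g)
    rw [hg] at e
    have he := e.comm j
    rw [dNext_eq _ (show (ComplexShape.up ℤ).Rel j k from hjk),
      prevD_eq _ (show (ComplexShape.up ℤ).Rel i j from hij), mkHomFromSingle_f] at he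
    refine ⟨(singleObjXSelf _ j G).inv ≫ e.hom j i, ?_⟩
    rw [← cancel_epi (singleObjXSelf (.up ℤ) j G).hom, he]
    simp
  · obtain ⟨g, hg⟩ := h₁ s n (mkHomFromSingle (f ≫ K.iCycles n) (by simp))
    obtain ⟨l, hl⟩ := exists_lift_cycles K (i := n) rfl
      ((singleObjXSelf (.up ℤ) n (S s).X₂).inv ≫ g.f n) (by rw [Category.assoc, g.comm]; simp)
    refine ⟨l, ?_⟩
    have := congrArg (fun φ => (singleObjXSelf (.up ℤ) n _).inv ≫ Hom.f φ n) hg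
    rw [← cancel_mono (K.iCycles n), Category.assoc, hl]
    simpa [single_map_f_self] using this

variable [IsGrothendieckAbelian.{w} C] {A B : ObjectProperty C}

/-- Every complex embeds into a complex in `tilde B` with cokernel in `dgLeft A B`. -/
lemma exists_shortExact_tilde_dgLeft (hAB : IsSmallCotorsionPair.{w} A B)
    (hgen : ContainsGenerator A) (K : CochainComplex C ℤ) :
    ∃ (L M : CochainComplex C ℤ) (j : K ⟶ L) (p : L ⟶ M) (w : j ≫ p = 0),
      (ShortComplex.mk j p w).ShortExact ∧ tilde B L ∧ dgLeft A B M := by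
  obtain ⟨ι, M, N, i, hi, hB, hB'⟩ := hAB.exists_generatingMonos
  obtain ⟨G, hG, hsep⟩ := hgen
  have h := hAB.isCotorsionPair
  let S (s : ι) : ShortComplex C := ShortComplex.mk (i s) (cokernel.π (i s)) (cokernel.condition _)
  have hS (s : ι) : (S s).ShortExact :=
    have := hi s
    { exact := ShortComplex.exact_cokernel _ }
  have hSA (s : ι) : A (S s).X₃ := (h.left_iff _).2 fun Y hY => (hB Y).1 hY s
  let T : (ι × ULift.{w} ℤ) ⊕ ULift.{w} ℤ → ShortComplex (CochainComplex C ℤ) :=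
    Sum.elim (fun x => ShortComplex.mk _ _ (by
        rw [← Functor.map_comp, (S x.1).zero, Functor.map_zero] :
          (single C (.up ℤ) x.2.down).map (S x.1).f ≫ (single C (.up ℤ) x.2.down).map (S x.1).g = 0))
      (fun n => mappingCone.triangleRotateShortComplex (𝟙 ((single C (.up ℤ) n.down).obj G)))
  have hT : ∀ s, (T s).ShortExact := by
    rintro (⟨s, n⟩ | n)
    · exact shortExact_single (hS s) n.down
    · exact shortExact_triangleRotateShortComplex _
  obtain ⟨L, M, j, p, w, hex, hL, hM⟩ := exists_shortExact_of_generating hT K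
  refine ⟨L, M, j, p, w, hex, tilde_of_forall_extension_single (S := S) hB' hsep
    (fun s n f => hL (Sum.inl (s, ⟨n⟩)) f) (fun n f => hL (Sum.inr ⟨n⟩) f),
    dgLeft_of_forall_ext_one h fun Y hY => hM Y ?_⟩
  rintro (⟨s, n⟩ | n)
  · exact ext_one_of_dgLeft h (dgLeft_single h (hSA s) n.down) hY
  -- The cokernel of the inclusion of the sphere into its cone is its shift, the sphere on `G` in
  -- degree `n - 1`.
  · exact ext_subsingleton_of_iso
      (((singleFunctors C).shiftIso 1 (n.down - 1) n.down (by simp)).symm.app G) (Iso.refl Y) 1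
      (ext_one_of_dgLeft h (dgLeft_single h hG (n.down - 1)) hY)

/-- If `tilde A` contains the exact complexes in `dgLeft A B`, then `tilde B` contains those in
`dgRight A B`. -/
lemma tilde_of_dgRight_of_acyclic (hAB : IsSmallCotorsionPair.{w} A B)
    (hgen : ContainsGenerator A) (hA : ∀ X, dgLeft A B X → X.Acyclic → tilde A X)
    {K : CochainComplex C ℤ} (hK : dgRight A B K) (hex : K.Acyclic) : tilde B K := by
  have h := hAB.isCotorsionPair
  obtain ⟨L, M, j, p, w, hS, hL, hM⟩ := exists_shortExact_tilde_dgLeft hAB hgen K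
  -- As `K` and `L` are exact, so is `M`; then `hA` puts `M` in `tilde A`, and orthogonality to `K`
  -- splits the sequence.
  have hj : QuasiIso j := ⟨fun n => (quasiIsoAt_iff_exactAt j n (hex n)).2 (hL.1 n)⟩
  have hMex : M.Acyclic := hS.acyclic_X₃ hj
  obtain ⟨r, hr⟩ := exists_extension_of_ext_one hS (ext_one_of_dgRight h (hA M hM hMex) hK) (𝟙 K)
  exact (isCotorsionPair_dgLeft_tilde h hgen).right_of_retract j r hr hL

end Completeness

end CotorsionPairs

open CotorsionPairs in
theorem mainTheorem7 {C : Type u} [Category.{v} C] [Abelian C] [IsGrothendieckAbelian.{w} C]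
    (A B : ObjectProperty C)
    (hAB : CotorsionPairs.IsSmallCotorsionPair.{w} A B)
    (hgen : CotorsionPairs.ContainsGenerator A) :
    CotorsionPairs.IsCotorsionPair.{w}
        (CotorsionPairs.dgLeft A B) (CotorsionPairs.tilde B) ∧
    CotorsionPairs.IsCotorsionPair.{w}
        (CotorsionPairs.tilde A) (CotorsionPairs.dgRight A B) ∧
    List.TFAE
      [ CotorsionPairs.InducedCompatible A B,
        CotorsionPairs.IsResolving A ∧ CotorsionPairs.IsCoresolving B,
        ∀ n : ℕ, 0 < n → ∀ X Y : C, A X → B Y → Subsingleton (Ext.{w} X Y n),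
        CotorsionPairs.tilde A =
          CotorsionPairs.dgLeft A B ⊓ CotorsionPairs.exactComplexes C ] := by
  have h := hAB.isCotorsionPair
  refine ⟨isCotorsionPair_dgLeft_tilde h hgen, isCotorsionPair_tilde_dgRight h, ?_⟩
  tfae_have 1 → 4 := fun h₁ => h₁.1.symm
  tfae_have 4 → 1 := fun h₄ => by
    refine ⟨h₄.symm, le_antisymm (fun K hK => ?_) fun K hK => ⟨dgRight_of_tilde h hK, hK.1⟩⟩
    exact tilde_of_dgRight_of_acyclic hAB hgen (fun X hX hex => h₄.ge X ⟨hX, hex⟩) hK.1 hK.2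
  tfae_have 1 → 3 := fun h₁ n hn => by
    obtain ⟨m, rfl⟩ := Nat.exists_eq_succ_of_ne_zero hn.ne'
    exact subsingleton_ext_of_tilde h (fun K hK hex => h₁.2.le K ⟨hK, hex⟩) m
  tfae_have 3 → 2 := fun h₃ => ⟨isResolving_of_ext_two h (h₃ 2 (by simp)),
    isCoresolving_of_ext_two h (h₃ 2 (by simp))⟩
  tfae_have 2 → 4 := fun h₂ =>
    le_antisymm (fun X hX => ⟨dgLeft_of_tilde h hX, hX.1⟩)
      fun X hX => tilde_of_dgLeft_of_acyclic h h₂.2 hX.1 hX.2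
  tfae_finish
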